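/- Let $H_\ell(x)=\frac{(-1)^\ell}{\sqrt{\ell!}}e^{x^2/2}\frac{d^\ell}{dx^\ell}e^{-x^2/2}$ be the normalized probabilists' Hermite polynomials. There is an absolute constant $c>0$ such that the following holds. Let $r:\mathbb N_0\to(0,\infty)$ satisfy $V:=\sum_{\ell=1}^\infty r(\ell)\,\ell^{11/6}<\infty$. Then the Hermite kernel $$K(x,y)=\sum_{\ell=0}^\infty r(\ell)H_\ell(x)H_\ell(y)$$ converges for all $x,y\in\mathbb R$, and $K(x,x)+K(y,y)-2K(x,y)\ge 0$. Let $(\xi_j)_{j\ge1}$ be real numbers with $\sum_{j=1}^\infty|\xi_j|<\infty$, let $\omega$ be a probability measure on $\mathbb R$, let $x_1,x_2,\dots$ be i.i.d. with distribution $\omega$ (i.e. $(x_j)_{j\ge1}\sim\omega^{\mathbb N}$), let $k\in\mathbb N_0$, and put $$Y_k=\sum_{j=1}^k x_j\xi_j,\qquad Y_\infty=\lim_{n\to\infty}\sum_{j=1}^n x_j\xi_j,\qquad Y_\infty^{\rm abs}=\sum_{j=1}^\infty|x_j\xi_j|\in[0,\infty]$$ (where the limit does not exist, $Y_\infty:=0$).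 Define the truncation error $$e^{\rm trnc}(k)=\Big[\mathbb E\big(K(Y_\infty,Y_\infty)+K(Y_k,Y_k)-2K(Y_\infty,Y_k)\big)\Big]^{1/2}.$$ All expectations are of nonnegative quantities and take values in $[0,\infty]$, with $e^\infty=\infty$ and $0\cdot\infty=0$. Then: 1. $\displaystyle e^{\rm trnc}(k)\le c\,\Big(\sqrt{2\pi}\,V\,\mathbb E\big[e^{(Y_\infty^{\rm abs})^2/2}(Y_\infty-Y_k)^2\big]\Big)^{1/2}.$ 2. If $\|e^{(Y_\infty^{\rm abs})^2/2}\|_{L_\infty}<\infty$, then $\displaystyle e^{\rm trnc}(k)\le c\,\Big(\sqrt{2\pi}\,V\,\|e^{(Y_\infty^{\rm abs})^2/2}\|_{L_\infty}\,\mathbb E\big[(Y_\infty-Y_k)^2\big]\Big)^{1/2}.$ 3. If $\omega$ is the uniform distribution on $[-1/2,1/2]$, then $\|e^{(Y_\infty^{\rm abs})^2/2}\|_{L_\infty}\le e^{\frac18(\sum_{j\ge1}|\xi_j|)^2}$ and, with $\widetilde c=c\,(\sqrt{2\pi}\,V/12)^{1/2}$, $$e^{\rm trnc}(k)\le\widetilde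 c\;e^{\frac1{16}\left(\sum_{j=1}^\infty|\xi_j|\right)^2}\Big(\sum_{j=k+1}^\infty\xi_j^2\Big)^{1/2}.$$ If moreover $|\xi_j|\le j^{-a}$ for all $j\ge1$ with some $a>1$, then $$e^{\rm trnc}(k)\le\frac{\widetilde c\;e^{\frac1{16}\zeta(a)^2}}{\sqrt{2a-1}}\,\frac1{(k+1/2)^{a-1/2}}.$$ 4. If $\mathbb E[e^{(Y_\infty^{\rm abs})^2}]<\infty$, then $\displaystyle \mathbb E\big[e^{(Y_\infty^{\rm abs})^2/2}(Y_\infty-Y_k)^2\big]\le\mathbb E\big[e^{(Y_\infty^{\rm abs})^2}\big]^{1/2}\,\mathbb E\big[(Y_\infty-Y_k)^4\big]^{1/2}$, and hence $$e^{\rm trnc}(k)\le c\,\Big(\sqrt{2\pi}\,V\,\mathbb E\big[e^{(Y_\infty^{\rm abs})^2}\big]^{1/2}\,\mathbb E\big[(Y_\infty-Y_k)^4\big]^{1/2}\Big)^{1/2}.$$ -/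

import Mathlib

open MeasureTheory
open scoped ENNReal

noncomputable section

namespace HermiteTruncation

/-- The `ℓ`-th normalized probabilists' Hermite polynomial, as a function on `ℝ`. -/
def hermiteFun (ℓ : ℕ) (x : ℝ) : ℝ :=
  Polynomial.aeval x (Polynomial.hermite ℓ) / Real.sqrt (Nat.factorial ℓ)

/-- Rodrigues' formula for `hermiteFun`. -/
theorem hermiteFun_eq (ℓ : ℕ) (x : ℝ) :
    hermiteFun ℓ x = (-1 : ℝ) ^ ℓ / Real.sqrt (Nat.factorial ℓ) * Real.exp (x ^ 2 / 2) *
      deriv^[ℓ] (fun y : ℝ => Real.exp (-(y ^ 2 / 2))) x := by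
  rw [hermiteFun, Polynomial.hermite_eq_deriv_gaussian']
  ring

/-- The Hermite kernel `∑_{ℓ ≥ 0} r(ℓ) H_ℓ(x) H_ℓ(y)`. -/
def hermiteKernel (r : ℕ → ℝ) (x y : ℝ) : ℝ :=
  ∑' ℓ : ℕ, r ℓ * hermiteFun ℓ x * hermiteFun ℓ y

/-- `V = ∑_{ℓ ≥ 1} r(ℓ) ℓ^{11/6}`, the summand with index `ℓ` here being the one of `ℓ + 1`. -/
def weightSum (r : ℕ → ℝ) : ℝ :=
  ∑' ℓ : ℕ, r (ℓ + 1) * ((ℓ : ℝ) + 1) ^ (11 / 6 : ℝ)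

/-- `Y_k = ∑_{j=1}^k x_j ξ_j`. Sequences `(x_j)_{j ≥ 1}` are indexed by `ℕ`, so that
`x j`, `ξ j` are the entries number `j + 1`. -/
def partialY (ξ : ℕ → ℝ) (k : ℕ) (x : ℕ → ℝ) : ℝ :=
  ∑ j ∈ Finset.range k, x j * ξ j

/-- `Y_∞ = ∑_{j=1}^∞ x_j ξ_j`, the limit of the partial sums `Y_k` as `k → ∞`
(and `0` where the partial sums do not converge). -/
def limitY (ξ : ℕ → ℝ) (x : ℕ → ℝ) : ℝ :=
  ∑'[SummationFilter.conditional ℕ] j : ℕ, x j * ξ j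

/-- `Y_∞` is the limit of the `Y_k` wherever that limit exists. -/
theorem limitY_eq_of_tendsto {ξ x : ℕ → ℝ} {y : ℝ}
    (h : Filter.Tendsto (fun k => partialY ξ k x) Filter.atTop (nhds y)) : limitY ξ x = y := by
  have hs : HasSum (fun j : ℕ => x j * ξ j) y (SummationFilter.conditional ℕ) := by
    rw [HasSum, SummationFilter.conditional_filter_eq_map_range, Filter.tendsto_map'_iff]
    exact h
  exact hs.tsum_eq

/-- `Y_∞^abs = ∑_{j=1}^∞ |x_j ξ_j|`, with values in `[0, ∞]`. -/
def absY (ξ : ℕ → ℝ) (x : ℕ → ℝ) : ℝ≥0∞ :=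
  ∑' j : ℕ, ENNReal.ofReal |x j * ξ j|

/-- The exponential of an element of `[0, ∞]`, with `exp ∞ = ∞`. -/
def expE (t : ℝ≥0∞) : ℝ≥0∞ :=
  EReal.exp (t : EReal)

/-- `ω^ℕ`, the law of a sequence of i.i.d. random variables with distribution `ω`. -/
def seqLaw (ω : Measure ℝ) : Measure (ℕ → ℝ) :=
  Measure.infinitePi (fun _ : ℕ => ω)

/-- `E_{ω^ℕ} |Y_∞ - Y_k|^M`, with values in `[0, ∞]`. -/
def tailMoment (M : ℕ) (ξ : ℕ → ℝ) (ω : Measure ℝ) (k : ℕ) : ℝ≥0∞ :=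
  ∫⁻ x, ENNReal.ofReal (|limitY ξ x - partialY ξ k x| ^ M) ∂(seqLaw ω)

/-- The truncation error
`e^trnc(k; K, ω) = (E_{ω^ℕ} (K(Y_∞, Y_∞) + K(Y_k, Y_k) - 2 K(Y_∞, Y_k)))^{1/2}`
of a positive semidefinite kernel `K` (the integrand is then nonnegative), with values in
`[0, ∞]`. -/
def truncError (K : ℝ → ℝ → ℝ) (ξ : ℕ → ℝ) (ω : Measure ℝ) (k : ℕ) : ℝ≥0∞ :=
  (∫⁻ x, ENNReal.ofReal
    (K (limitY ξ x) (limitY ξ x) + K (partialY ξ k x) (partialY ξ k x)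
      - 2 * K (limitY ξ x) (partialY ξ k x)) ∂(seqLaw ω)) ^ (1 / 2 : ℝ)

end HermiteTruncation

end

/-! Everything rests on one growth bound, `hermiteFun_sq_le`: `H_n(x)² ≤ e √(n+1) e^{x²/2}`. It
follows from Rodrigues' formula, Cauchy's estimate for the entire function `e^{-z²/2}` on a circle
of radius `√n` about `x`, and Stirling's bound. Since `H_{n+1}' = √(n+1) H_n`, the mean value
inequality makes `(H_{n+1}(x) - H_{n+1}(y))²` at most `(n+1)^{3/2} e e^{M²/2} (x-y)²` when `|x|, |y|
≤ M`. The kernel distance is the sum of these squares weighted by `r`, and `3/2 ≤ 11/6`, so it is at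
most `e V e^{M²/2} (x-y)²`. Taking `M = Y_∞^abs`, which dominates both `|Y_∞|` and `|Y_k|`, and
integrating gives the main bound. The other bounds come from the essential supremum, from
Cauchy–Schwarz, and, in the uniform case, from the variance of a sum of independent centred terms;
power decay adds a midpoint comparison of the tail with an integral. -/

/-! ### Hermite polynomials: derivatives, growth and Lipschitz bounds -/

open Polynomial in
/-- The derivative of the Hermite polynomials. -/
theorem Polynomial.derivative_hermite_succ (n : ℕ) :
    derivative (hermite (n + 1)) = ((n : ℤ[X]) + 1) * hermite n := by
  induction n with
  | zero => simp
  | succ n ih =>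
    have h2 : derivative (derivative (hermite (n + 1)))
        = ((n : ℤ[X]) + 1) * derivative (hermite n) := by
      rw [ih]; simp
    rw [hermite_succ (n + 1), derivative_sub, derivative_mul, h2, ih, derivative_X,
      hermite_succ n]
    push_cast
    ring

open Polynomial in
/-- Rodrigues' formula over `ℂ`. -/
theorem Polynomial.iteratedDeriv_gaussian_complex (n : ℕ) :
    iteratedDeriv n (fun y : ℂ => Complex.exp (-(y ^ 2 / 2))) =
      fun x => (-1 : ℂ) ^ n * aeval x (hermite n) * Complex.exp (-(x ^ 2 / 2)) := by
  induction n with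
  | zero => ext x; simp
  | succ n ih =>
    ext x
    have h1 : HasDerivAt (fun y : ℂ => Complex.exp (-(y ^ 2 / 2)))
        (Complex.exp (-(x ^ 2 / 2)) * (-x)) x := by
      have h0 : HasDerivAt (fun y : ℂ => -(y ^ 2 / 2)) (-x) x := by
        have := ((hasDerivAt_pow 2 x).div_const 2).neg
        convert! this using 1
        simp
      exact h0.cexp
    have h2 : HasDerivAt (fun y : ℂ => aeval y (hermite n))
        (aeval x (derivative (hermite n))) x := (hermite n).hasDerivAt_aeval x
    have h3 : HasDerivAt
        (fun y : ℂ => (-1 : ℂ) ^ n * aeval y (hermite n) * Complex.exp (-(y ^ 2 / 2))) _ x :=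
      (h2.const_mul ((-1 : ℂ) ^ n)).mul h1
    rw [iteratedDeriv_succ, ih, h3.deriv, hermite_succ, map_sub, map_mul, aeval_X, pow_succ]
    ring

namespace HermiteTruncation

theorem aeval_hermite_ofReal (n : ℕ) (x : ℝ) :
    Polynomial.aeval (x : ℂ) (Polynomial.hermite n)
      = ((Polynomial.aeval x (Polynomial.hermite n) : ℝ) : ℂ) :=
  Polynomial.aeval_algebraMap_apply ℂ x _

/-- Cauchy's estimate for the `n`-th derivative of `e^{-z²/2}` at `x`. On the circle the modulus is
at most `e^{R²/2 - x²/4}`, and undoing the Gaussian factor of Rodrigues' formula costs `e^{x²/2}`,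
which leaves `e^{x²/4}`. -/
theorem abs_aeval_hermite_le (n : ℕ) (x : ℝ) {R : ℝ} (hR : 0 < R) :
    |Polynomial.aeval x (Polynomial.hermite n)| ≤
      n.factorial * Real.exp (R ^ 2 / 2) / R ^ n * Real.exp (x ^ 2 / 4) := by
  have hd : Differentiable ℂ (fun y : ℂ => Complex.exp (-(y ^ 2 / 2))) := by fun_prop
  have key := Complex.norm_iteratedDeriv_le_of_forall_mem_sphere_norm_le (c := (x : ℂ))
    (C := Real.exp (R ^ 2 / 2 - x ^ 2 / 4)) n hR hd.diffContOnCl (by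
      intro z hz
      rw [Complex.norm_exp]
      apply Real.exp_le_exp.mpr
      have h1 : (z.re - x) ^ 2 + z.im ^ 2 = R ^ 2 := by
        have h2 : ‖z - x‖ = R := by simpa [dist_eq_norm] using hz
        rw [← h2, Complex.sq_norm, Complex.normSq_apply]
        simp
        ring
      have h3 : (-(z ^ 2 / 2)).re = -((z.re ^ 2 - z.im ^ 2) / 2) := by
        rw [Complex.neg_re, show z ^ 2 / 2 = z ^ 2 / ((2 : ℝ) : ℂ) by norm_num,
          Complex.div_ofReal_re, sq z, Complex.mul_re]
        ring
      rw [h3]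
      -- On the circle the exponent equals `R²/2 - x²/4 - (Re z - x/2)²`.
      nlinarith [sq_nonneg (z.re - x / 2)])
  rw [Polynomial.iteratedDeriv_gaussian_complex] at key
  simp only [aeval_hermite_ofReal, norm_mul, norm_pow, norm_neg, norm_one, one_pow, one_mul,
    Complex.norm_real, Real.norm_eq_abs, Complex.norm_exp] at key
  have h4 : (-((x : ℂ) ^ 2 / 2)).re = -(x ^ 2 / 2) := by
    rw [show -((x : ℂ) ^ 2 / 2) = ((-(x ^ 2 / 2) : ℝ) : ℂ) by push_cast; ring, Complex.ofReal_re]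
  rw [h4] at key
  have h5 := mul_le_mul_of_nonneg_right key (Real.exp_pos (x ^ 2 / 2)).le
  rw [mul_assoc, ← Real.exp_add, neg_add_cancel, Real.exp_zero, mul_one] at h5
  refine h5.trans_eq ?_
  have h6 : Real.exp (R ^ 2 / 2 - x ^ 2 / 4) * Real.exp (x ^ 2 / 2)
      = Real.exp (R ^ 2 / 2) * Real.exp (x ^ 2 / 4) := by
    rw [← Real.exp_add, ← Real.exp_add]; ring_nf
  linear_combination (n.factorial / R ^ n : ℝ) * h6

/-- The Stirling sequence decreases, so it stays below its value `e/√2` at `n = 1`. -/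
theorem factorial_le_stirling {n : ℕ} (hn : n ≠ 0) :
    (n.factorial : ℝ) ≤ Real.exp 1 * Real.sqrt n * (n / Real.exp 1) ^ n := by
  obtain ⟨m, rfl⟩ := Nat.exists_eq_succ_of_ne_zero hn
  have h := Stirling.stirlingSeq'_antitone (Nat.zero_le m)
  simp only [Function.comp_apply, Nat.succ_eq_add_one, zero_add, Stirling.stirlingSeq_one] at h
  rw [Stirling.stirlingSeq, div_le_div_iff₀ (by positivity) (by positivity),
    Real.sqrt_mul (by norm_num)] at h
  have h2 : (0 : ℝ) < Real.sqrt 2 := by positivity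
  refine le_of_mul_le_mul_right (h.trans_eq ?_) h2
  simp only [Nat.succ_eq_add_one]
  ring

theorem hermiteFun_sq_le (n : ℕ) (x : ℝ) :
    hermiteFun n x ^ 2 ≤ Real.exp 1 * Real.sqrt (n + 1) * Real.exp (x ^ 2 / 2) := by
  rcases eq_or_ne n 0 with rfl | hn
  · have h1 : 1 ≤ Real.exp 1 := Real.one_le_exp (by norm_num)
    have h2 : 1 ≤ Real.exp (x ^ 2 / 2) := Real.one_le_exp (by positivity)
    simp [hermiteFun]
    nlinarith
  · have hn0 : (0 : ℝ) < n := by positivity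
    have hf : (0 : ℝ) < n.factorial := by positivity
    -- The radius `√n` minimises `e^{R²/2} / R^n`.
    have h := abs_aeval_hermite_le n x (R := Real.sqrt n) (by positivity)
    have h' := pow_le_pow_left₀ (abs_nonneg _) h 2
    rw [sq_abs] at h'
    have e1 : Real.exp (Real.sqrt n ^ 2 / 2) ^ 2 = Real.exp 1 ^ n := by
      rw [Real.sq_sqrt hn0.le, ← Real.exp_nat_mul, ← Real.exp_nat_mul]
      congr 1; push_cast; ring
    have e2 : Real.exp (x ^ 2 / 4) ^ 2 = Real.exp (x ^ 2 / 2) := by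
      rw [← Real.exp_nat_mul]; congr 1; push_cast; ring
    have e3 : (Real.sqrt n ^ n) ^ 2 = (n : ℝ) ^ n := by
      rw [← pow_mul, mul_comm, pow_mul, Real.sq_sqrt hn0.le]
    rw [mul_pow, div_pow, mul_pow, e1, e2, e3] at h'
    have hs := factorial_le_stirling hn
    rw [hermiteFun, div_pow, Real.sq_sqrt hf.le, div_le_iff₀ hf]
    refine h'.trans ?_
    have h7 : (n.factorial : ℝ) * Real.exp 1 ^ n / (n : ℝ) ^ n ≤
        Real.exp 1 * Real.sqrt (n + 1) := by
      rw [div_le_iff₀ (by positivity)]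
      have h8 := mul_le_mul_of_nonneg_right hs (by positivity : 0 ≤ Real.exp 1 ^ n)
      refine h8.trans ?_
      rw [div_pow, mul_assoc, div_mul_cancel₀ _ (by positivity)]
      gcongr
      linarith
    calc (n.factorial : ℝ) ^ 2 * Real.exp 1 ^ n / (n : ℝ) ^ n * Real.exp (x ^ 2 / 2)
        = n.factorial * Real.exp 1 ^ n / (n : ℝ) ^ n * (Real.exp (x ^ 2 / 2) * n.factorial) := by
          ring
      _ ≤ Real.exp 1 * Real.sqrt (n + 1) * (Real.exp (x ^ 2 / 2) * n.factorial) := by gcongr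
      _ = _ := by ring

theorem hasDerivAt_hermiteFun_succ (n : ℕ) (x : ℝ) :
    HasDerivAt (hermiteFun (n + 1)) (Real.sqrt (n + 1) * hermiteFun n x) x := by
  have h := ((Polynomial.hermite (n + 1)).hasDerivAt_aeval x).div_const
    (Real.sqrt (Nat.factorial (n + 1)))
  convert! h using 1
  rw [Polynomial.derivative_hermite_succ, map_mul, hermiteFun, Nat.factorial_succ]
  push_cast
  rw [Real.sqrt_mul (by positivity)]
  have h1 : (0 : ℝ) < Real.sqrt (n + 1) := by positivity
  have h2 : (0 : ℝ) < Real.sqrt n.factorial := by positivity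
  have h3 : Real.sqrt ((n : ℝ) + 1) ^ 2 = n + 1 := Real.sq_sqrt (by positivity)
  simp only [map_add, map_natCast, map_one]
  field_simp
  rw [h3]

/-- The left side is the power `3/2` produced by the derivative bound; the exponent `11/6` leaves
room. -/
theorem add_one_mul_sqrt_le_rpow (n : ℕ) :
    ((n : ℝ) + 1) * Real.sqrt (n + 1) ≤ ((n : ℝ) + 1) ^ (11 / 6 : ℝ) := by
  rw [Real.sqrt_eq_rpow]
  nth_rw 1 [← Real.rpow_one ((n : ℝ) + 1)]
  rw [← Real.rpow_add (by positivity)]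
  exact Real.rpow_le_rpow_of_exponent_le (by linarith [n.cast_nonneg (α := ℝ)]) (by norm_num)

/-- Mean value inequality on `[-M, M]`, with the growth bound applied to the derivative `√(n+1)
H_n`. -/
theorem hermiteFun_sub_sq_le (n : ℕ) {x y M : ℝ} (hx : |x| ≤ M) (hy : |y| ≤ M) :
    (hermiteFun (n + 1) x - hermiteFun (n + 1) y) ^ 2 ≤
      ((n : ℝ) + 1) ^ (11 / 6 : ℝ) * (Real.exp 1 * Real.exp (M ^ 2 / 2) * (x - y) ^ 2) := by
  have hM : 0 ≤ M := (abs_nonneg x).trans hx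
  set B := Real.sqrt ((n : ℝ) + 1) *
    Real.sqrt (Real.exp 1 * Real.sqrt (n + 1) * Real.exp (M ^ 2 / 2)) with hB
  have hbd : ∀ z ∈ Set.Icc (-M) M, ‖Real.sqrt (n + 1) * hermiteFun n z‖ ≤ B := by
    intro z hz
    rw [norm_mul, Real.norm_eq_abs, Real.norm_eq_abs, abs_of_nonneg (Real.sqrt_nonneg _)]
    refine mul_le_mul_of_nonneg_left (Real.abs_le_sqrt ((hermiteFun_sq_le n z).trans ?_))
      (Real.sqrt_nonneg _)
    have : z ^ 2 ≤ M ^ 2 := sq_le_sq' hz.1 hz.2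
    gcongr
  have key := (convex_Icc (-M) M).norm_image_sub_le_of_norm_hasDerivWithin_le
    (fun z _ => (hasDerivAt_hermiteFun_succ n z).hasDerivWithinAt) hbd (abs_le.mp hy) (abs_le.mp hx)
  have h2 := pow_le_pow_left₀ (norm_nonneg _) key 2
  rw [Real.norm_eq_abs, Real.norm_eq_abs, sq_abs, mul_pow, sq_abs, hB, mul_pow,
    Real.sq_sqrt (by positivity), Real.sq_sqrt (by positivity)] at h2
  refine h2.trans ?_
  have h3 := mul_le_mul_of_nonneg_right (add_one_mul_sqrt_le_rpow n)
    (by positivity : 0 ≤ Real.exp 1 * Real.exp (M ^ 2 / 2) * (x - y) ^ 2)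
  exact le_trans (le_of_eq (by ring)) h3

theorem abs_hermiteFun_succ_mul_le (n : ℕ) (x y : ℝ) :
    |hermiteFun (n + 1) x * hermiteFun (n + 1) y| ≤ ((n : ℝ) + 1) ^ (11 / 6 : ℝ) *
      (2 * Real.exp 1 * (Real.exp (x ^ 2 / 2) + Real.exp (y ^ 2 / 2))) := by
  have hx := hermiteFun_sq_le (n + 1) x
  have hy := hermiteFun_sq_le (n + 1) y
  have h1 : Real.sqrt (((n + 1 : ℕ) : ℝ) + 1) ≤ 2 * ((n : ℝ) + 1) ^ (11 / 6 : ℝ) := by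
    have hn : (1 : ℝ) ≤ n + 1 := by linarith [n.cast_nonneg (α := ℝ)]
    have h2 : (n : ℝ) + 1 ≤ ((n : ℝ) + 1) ^ (11 / 6 : ℝ) :=
      Real.self_le_rpow_of_one_le hn (by norm_num)
    refine Real.sqrt_le_iff.mpr ⟨by positivity, ?_⟩
    push_cast
    nlinarith
  set s := Real.sqrt (((n + 1 : ℕ) : ℝ) + 1)
  set a := hermiteFun (n + 1) x
  set b := hermiteFun (n + 1) y
  have h3 : |a * b| ≤ a ^ 2 + b ^ 2 := by
    rw [abs_le]
    constructor <;> nlinarith [sq_nonneg (a + b), sq_nonneg (a - b)]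
  have h4 := mul_le_mul_of_nonneg_right h1
    (by positivity : 0 ≤ Real.exp 1 * (Real.exp (x ^ 2 / 2) + Real.exp (y ^ 2 / 2)))
  linarith

/-! ### The Hermite kernel and its distance -/

section Kernel

variable {r : ℕ → ℝ}

theorem summable_hermiteKernel (hr : ∀ ℓ, 0 < r ℓ)
    (hV : Summable (fun ℓ : ℕ => r (ℓ + 1) * ((ℓ : ℝ) + 1) ^ (11 / 6 : ℝ))) (x y : ℝ) :
    Summable (fun ℓ : ℕ => r ℓ * hermiteFun ℓ x * hermiteFun ℓ y) := by
  rw [← summable_nat_add_iff 1]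
  refine Summable.of_norm_bounded
    (hV.mul_right (2 * Real.exp 1 * (Real.exp (x ^ 2 / 2) + Real.exp (y ^ 2 / 2)))) fun n => ?_
  rw [mul_assoc, norm_mul, Real.norm_eq_abs, abs_of_pos (hr _), Real.norm_eq_abs, mul_assoc]
  exact mul_le_mul_of_nonneg_left (abs_hermiteFun_succ_mul_le n x y) (hr _).le

/-- Expanding the squares gives the identity; the term of index `0` drops out because `H_0` is
constant, so `r 0` plays no role. -/
theorem hasSum_hermiteKernel_dist (hr : ∀ ℓ, 0 < r ℓ)
    (hV : Summable (fun ℓ : ℕ => r (ℓ + 1) * ((ℓ : ℝ) + 1) ^ (11 / 6 : ℝ))) (x y : ℝ) :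
    HasSum (fun ℓ : ℕ => r (ℓ + 1) * (hermiteFun (ℓ + 1) x - hermiteFun (ℓ + 1) y) ^ 2)
      (hermiteKernel r x x + hermiteKernel r y y - 2 * hermiteKernel r x y) := by
  have h := (((summable_hermiteKernel hr hV x x).hasSum.add
    (summable_hermiteKernel hr hV y y).hasSum).sub
      ((summable_hermiteKernel hr hV x y).hasSum.mul_left 2))
  rw [← hasSum_nat_add_iff' 1] at h
  convert! h using 1
  · ext n; ring
  · simp [hermiteKernel, hermiteFun]; ring

theorem hermiteKernel_dist_nonneg (hr : ∀ ℓ, 0 < r ℓ)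
    (hV : Summable (fun ℓ : ℕ => r (ℓ + 1) * ((ℓ : ℝ) + 1) ^ (11 / 6 : ℝ))) (x y : ℝ) :
    0 ≤ hermiteKernel r x x + hermiteKernel r y y - 2 * hermiteKernel r x y :=
  (hasSum_hermiteKernel_dist hr hV x y).nonneg fun _ => mul_nonneg (hr _).le (sq_nonneg _)

theorem hermiteKernel_dist_le (hr : ∀ ℓ, 0 < r ℓ)
    (hV : Summable (fun ℓ : ℕ => r (ℓ + 1) * ((ℓ : ℝ) + 1) ^ (11 / 6 : ℝ))) {x y M : ℝ}
    (hx : |x| ≤ M) (hy : |y| ≤ M) :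
    hermiteKernel r x x + hermiteKernel r y y - 2 * hermiteKernel r x y ≤
      Real.exp 1 * weightSum r * (Real.exp (M ^ 2 / 2) * (x - y) ^ 2) := by
  have h := hasSum_le (fun n => ?_) (hasSum_hermiteKernel_dist hr hV x y)
    (hV.hasSum.mul_right (Real.exp 1 * Real.exp (M ^ 2 / 2) * (x - y) ^ 2))
  · exact h.trans_eq (by rw [weightSum]; ring)
  · rw [mul_assoc]
    exact mul_le_mul_of_nonneg_left (hermiteFun_sub_sq_le n hx hy) (hr _).le

theorem weightSum_pos (hr : ∀ ℓ, 0 < r ℓ)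
    (hV : Summable (fun ℓ : ℕ => r (ℓ + 1) * ((ℓ : ℝ) + 1) ^ (11 / 6 : ℝ))) :
    0 < weightSum r :=
  hV.tsum_pos (fun n => (mul_pos (hr _) (by positivity)).le) 0 (mul_pos (hr _) (by positivity))

end Kernel

/-! ### Pointwise estimates along a sequence, with values in `[0, ∞]` -/

open Filter Topology

section Pointwise

variable {ξ x : ℕ → ℝ}

theorem summable_abs_of_absY_ne_top (h : absY ξ x ≠ ∞) : Summable fun j => |x j * ξ j| := by
  refine (ENNReal.summable_toReal h).congr fun j => ?_
  rw [ENNReal.toReal_ofReal (abs_nonneg _)]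

theorem toReal_absY (h : absY ξ x ≠ ∞) : (absY ξ x).toReal = ∑' j, |x j * ξ j| := by
  rw [absY, ← ENNReal.ofReal_tsum_of_nonneg (fun _ => abs_nonneg _)
    (summable_abs_of_absY_ne_top h), ENNReal.toReal_ofReal (tsum_nonneg fun _ => abs_nonneg _)]

theorem tendsto_partialY (h : absY ξ x ≠ ∞) :
    Tendsto (fun k => partialY ξ k x) atTop (𝓝 (limitY ξ x)) := by
  have hs := (summable_abs_of_absY_ne_top h).of_abs.hasSum.tendsto_sum_nat
  rwa [limitY_eq_of_tendsto hs]

theorem abs_partialY_le (h : absY ξ x ≠ ∞) (k : ℕ) : |partialY ξ k x| ≤ (absY ξ x).toReal := by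
  rw [toReal_absY h]
  exact (Finset.abs_sum_le_sum_abs _ _).trans
    ((summable_abs_of_absY_ne_top h).sum_le_tsum _ fun _ _ => abs_nonneg _)

theorem abs_limitY_le (h : absY ξ x ≠ ∞) : |limitY ξ x| ≤ (absY ξ x).toReal :=
  le_of_tendsto (tendsto_partialY h).abs (Eventually.of_forall fun k => abs_partialY_le h k)

theorem expE_top : expE ∞ = ∞ := by simp [expE]

theorem expE_eq_ofReal {t : ℝ≥0∞} (ht : t ≠ ∞) : expE t = ENNReal.ofReal (Real.exp t.toReal) := by
  rw [expE, ← EReal.exp_coe, EReal.coe_ennreal_toReal ht]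

theorem expE_add (s t : ℝ≥0∞) : expE (s + t) = expE s * expE t := by
  rw [expE, EReal.coe_ennreal_add, EReal.exp_add, expE, expE]

theorem measurable_expE : Measurable expE :=
  EReal.measurable_exp.comp measurable_coe_ennreal_ereal

theorem absY_sq_div_two_eq_top (h : absY ξ x = ∞) : absY ξ x ^ 2 / 2 = ∞ := by
  rw [h, ENNReal.top_pow two_ne_zero, ENNReal.top_div_of_ne_top (by norm_num)]

theorem expE_absY_sq_div_two (h : absY ξ x ≠ ∞) :
    expE (absY ξ x ^ 2 / 2) = ENNReal.ofReal (Real.exp ((absY ξ x).toReal ^ 2 / 2)) := by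
  rw [expE_eq_ofReal (ENNReal.div_ne_top (ENNReal.pow_ne_top h) two_ne_zero), ENNReal.toReal_div,
    ENNReal.toReal_pow, ENNReal.toReal_ofNat]

/-- Where `absY` is infinite, the right side is `∞` unless `Y_∞ = Y_k`, in which case both sides
vanish by `∞ * 0 = 0`. The bound therefore holds everywhere, including where `limitY` takes its
default value, and no assumption on the law is needed. -/
theorem ofReal_hermiteKernel_dist_le {r : ℕ → ℝ} (hr : ∀ ℓ, 0 < r ℓ)
    (hV : Summable (fun ℓ : ℕ => r (ℓ + 1) * ((ℓ : ℝ) + 1) ^ (11 / 6 : ℝ))) (ξ x : ℕ → ℝ) (k : ℕ) :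
    ENNReal.ofReal (hermiteKernel r (limitY ξ x) (limitY ξ x)
        + hermiteKernel r (partialY ξ k x) (partialY ξ k x)
        - 2 * hermiteKernel r (limitY ξ x) (partialY ξ k x)) ≤
      ENNReal.ofReal (Real.exp 1 * weightSum r) * (expE (absY ξ x ^ 2 / 2) *
        ENNReal.ofReal ((limitY ξ x - partialY ξ k x) ^ 2)) := by
  have hV0 := weightSum_pos hr hV
  have hc : 0 < Real.exp 1 * weightSum r := by positivity
  by_cases h : absY ξ x = ∞
  · by_cases hY : limitY ξ x = partialY ξ k x
    · rw [hY, show ∀ a : ℝ, a + a - 2 * a = 0 by intro a; ring]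
      simp
    · have h0 : 0 < (limitY ξ x - partialY ξ k x) ^ 2 := by
        have := sub_ne_zero.mpr hY
        positivity
      rw [absY_sq_div_two_eq_top h, expE_top, ENNReal.top_mul (ENNReal.ofReal_pos.mpr h0).ne',
        ENNReal.mul_top (ENNReal.ofReal_pos.mpr hc).ne']
      exact le_top
  · rw [expE_absY_sq_div_two h, ← ENNReal.ofReal_mul (Real.exp_pos _).le,
      ← ENNReal.ofReal_mul hc.le]
    exact ENNReal.ofReal_le_ofReal
      (hermiteKernel_dist_le hr hV (abs_limitY_le h) (abs_partialY_le h k))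

end Pointwise

/-! ### Integrated bounds for a general law -/

theorem truncError_le {r : ℕ → ℝ} (hr : ∀ ℓ, 0 < r ℓ)
    (hV : Summable (fun ℓ : ℕ => r (ℓ + 1) * ((ℓ : ℝ) + 1) ^ (11 / 6 : ℝ))) (ξ : ℕ → ℝ)
    (ω : Measure ℝ) (k : ℕ) :
    truncError (hermiteKernel r) ξ ω k ≤ ENNReal.ofReal 2 *
      (ENNReal.ofReal (Real.sqrt (2 * Real.pi) * weightSum r) *
        ∫⁻ x, expE (absY ξ x ^ 2 / 2) * ENNReal.ofReal ((limitY ξ x - partialY ξ k x) ^ 2)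
          ∂(seqLaw ω)) ^ (1 / 2 : ℝ) := by
  have hV0 := weightSum_pos hr hV
  -- The constant `c = 2` comes from `e ≤ 4 √(2π)`; the square root turns `2²` into `2`.
  have h1 : Real.exp 1 * weightSum r ≤ 2 ^ 2 * (Real.sqrt (2 * Real.pi) * weightSum r) := by
    have h2 : 1 ≤ Real.sqrt (2 * Real.pi) :=
      Real.one_le_sqrt.mpr (by linarith [Real.pi_gt_three])
    nlinarith [Real.exp_one_lt_d9, mul_le_mul_of_nonneg_right h2 hV0.le]
  have h3 := lintegral_mono (μ := seqLaw ω) (ofReal_hermiteKernel_dist_le hr hV ξ · k)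
  rw [lintegral_const_mul' _ _ ENNReal.ofReal_ne_top] at h3
  have h4 := h3.trans (mul_le_mul_left (ENNReal.ofReal_le_ofReal h1) _)
  rw [ENNReal.ofReal_mul (by norm_num), ENNReal.ofReal_pow (by norm_num), mul_assoc] at h4
  refine (ENNReal.rpow_le_rpow h4 (by norm_num : (0 : ℝ) ≤ 1 / 2)).trans_eq ?_
  rw [ENNReal.mul_rpow_of_nonneg _ _ (by norm_num), ← ENNReal.rpow_natCast, ← ENNReal.rpow_mul]
  norm_num

theorem tailMoment_two (ξ : ℕ → ℝ) (ω : Measure ℝ) (k : ℕ) :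
    tailMoment 2 ξ ω k =
      ∫⁻ x, ENNReal.ofReal ((limitY ξ x - partialY ξ k x) ^ 2) ∂(seqLaw ω) := by
  simp only [tailMoment, sq_abs]

theorem lintegral_le_eLpNorm_mul_tailMoment {ξ : ℕ → ℝ} {ω : Measure ℝ} (k : ℕ)
    (h : eLpNorm (fun x => expE (absY ξ x ^ 2 / 2)) ∞ (seqLaw ω) < ∞) :
    ∫⁻ x, expE (absY ξ x ^ 2 / 2) * ENNReal.ofReal ((limitY ξ x - partialY ξ k x) ^ 2)
      ∂(seqLaw ω) ≤
      eLpNorm (fun x => expE (absY ξ x ^ 2 / 2)) ∞ (seqLaw ω) * tailMoment 2 ξ ω k := by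
  rw [tailMoment_two, ← lintegral_const_mul' _ _ h.ne]
  refine lintegral_mono_ae ?_
  have h1 := enorm_ae_le_eLpNormEssSup (fun x => expE (absY ξ x ^ 2 / 2)) (seqLaw ω)
  rw [← eLpNorm_exponent_top] at h1
  filter_upwards [h1] with x hx
  exact mul_le_mul_left hx _

theorem measurable_absY (ξ : ℕ → ℝ) : Measurable (absY ξ) := by
  unfold absY
  fun_prop

theorem measurable_partialY (ξ : ℕ → ℝ) (k : ℕ) : Measurable (partialY ξ k) := by
  unfold partialY
  fun_prop

theorem aemeasurable_limitY {ξ : ℕ → ℝ} {μ : Measure (ℕ → ℝ)} (h : ∀ᵐ x ∂μ, absY ξ x ≠ ∞) :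
    AEMeasurable (limitY ξ) μ :=
  aemeasurable_of_tendsto_metrizable_ae' (fun k => (measurable_partialY ξ k).aemeasurable)
    (h.mono fun _ hx => tendsto_partialY hx)

/-- Cauchy–Schwarz. Finiteness of the exponential moment forces `absY` to be finite almost
everywhere, so `limitY` is an a.e. limit of measurable partial sums and has the measurability that
Hölder requires. -/
theorem lintegral_le_sqrt_mul_sqrt {ξ : ℕ → ℝ} {ω : Measure ℝ} (k : ℕ)
    (h : ∫⁻ x, expE (absY ξ x ^ 2) ∂(seqLaw ω) < ∞) :
    ∫⁻ x, expE (absY ξ x ^ 2 / 2) * ENNReal.ofReal ((limitY ξ x - partialY ξ k x) ^ 2)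
      ∂(seqLaw ω) ≤
      (∫⁻ x, expE (absY ξ x ^ 2) ∂(seqLaw ω)) ^ (1 / 2 : ℝ) *
        tailMoment 4 ξ ω k ^ (1 / 2 : ℝ) := by
  have hm := measurable_absY ξ
  have hfin : ∀ᵐ x ∂(seqLaw ω), absY ξ x ≠ ∞ := by
    filter_upwards [ae_lt_top (measurable_expE.comp (hm.pow_const 2)) h.ne] with x hx hx'
    simp [hx', expE_top] at hx
  have hY := aemeasurable_limitY hfin
  have hP := measurable_partialY ξ k
  have key := ENNReal.lintegral_mul_le_Lp_mul_Lq (seqLaw ω) Real.HolderConjugate.two_two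
    (f := fun x => expE (absY ξ x ^ 2 / 2))
    (g := fun x => ENNReal.ofReal ((limitY ξ x - partialY ξ k x) ^ 2))
    (measurable_expE.comp ((hm.pow_const 2).div_const 2)).aemeasurable
    ((hY.sub hP.aemeasurable).pow_const 2).ennreal_ofReal
  refine key.trans_eq ?_
  simp only [ENNReal.rpow_two, sq (expE _), ← expE_add, ENNReal.add_halves, tailMoment,
    ← ENNReal.ofReal_pow (sq_nonneg _), ← pow_mul]
  congr! 5 with x
  exact (Even.pow_abs (by decide) _).symm

/-! ### The uniform distribution on `[-1/2, 1/2]` -/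

open ProbabilityTheory

section Uniform

/-- The uniform distribution on `[-1/2, 1/2]`. -/
noncomputable abbrev uniformHalf : Measure ℝ := volume.restrict (Set.Icc (-(1 / 2) : ℝ) (1 / 2))

instance : IsProbabilityMeasure uniformHalf := ⟨by simp; norm_num⟩

instance (ω : Measure ℝ) [IsProbabilityMeasure ω] : IsProbabilityMeasure (seqLaw ω) := by
  unfold seqLaw
  infer_instance

theorem measurePreserving_eval_seqLaw (ω : Measure ℝ) [IsProbabilityMeasure ω] (j : ℕ) :
    MeasurePreserving (fun x : ℕ → ℝ => x j) (seqLaw ω) ω :=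
  measurePreserving_eval_infinitePi (fun _ : ℕ => ω) j

theorem ae_abs_le_half : ∀ᵐ x ∂(seqLaw uniformHalf), ∀ j, |x j| ≤ 1 / 2 := by
  rw [ae_all_iff]
  intro j
  have h : ∀ᵐ t ∂uniformHalf, |t| ≤ 1 / 2 := by
    filter_upwards [ae_restrict_mem measurableSet_Icc] with t ht using abs_le.mpr ht
  exact (measurePreserving_eval_seqLaw uniformHalf j).quasiMeasurePreserving.ae h

variable {ξ : ℕ → ℝ}

theorem absY_le_of_abs_le_half (hξ : Summable fun j => |ξ j|) {x : ℕ → ℝ}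
    (hx : ∀ j, |x j| ≤ 1 / 2) : absY ξ x ≤ ENNReal.ofReal (1 / 2 * ∑' j, |ξ j|) := by
  rw [← tsum_mul_left, ENNReal.ofReal_tsum_of_nonneg (fun j => by positivity) (hξ.mul_left _)]
  refine ENNReal.tsum_le_tsum fun j => ENNReal.ofReal_le_ofReal ?_
  rw [abs_mul]
  exact mul_le_mul_of_nonneg_right (hx j) (abs_nonneg _)

theorem eLpNorm_expE_absY_uniformHalf_le (hξ : Summable fun j => |ξ j|) :
    eLpNorm (fun x => expE (absY ξ x ^ 2 / 2)) ∞ (seqLaw uniformHalf) ≤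
      ENNReal.ofReal (Real.exp (1 / 8 * (∑' j : ℕ, |ξ j|) ^ 2)) := by
  rw [eLpNorm_exponent_top]
  refine essSup_le_of_ae_le _ ?_
  filter_upwards [ae_abs_le_half] with x hx
  have hS : 0 ≤ ∑' j, |ξ j| := tsum_nonneg fun _ => abs_nonneg _
  have h := absY_le_of_abs_le_half hξ hx
  have hne : absY ξ x ≠ ∞ := ne_top_of_le_ne_top ENNReal.ofReal_ne_top h
  rw [enorm_eq_self, expE_absY_sq_div_two hne]
  refine ENNReal.ofReal_le_ofReal (Real.exp_le_exp.mpr ?_)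
  have h' := ENNReal.toReal_le_of_le_ofReal (by positivity) h
  have := pow_le_pow_left₀ ENNReal.toReal_nonneg h' 2
  linarith

theorem integral_uniformHalf : ∫ t, t ∂uniformHalf = 0 := by
  rw [integral_Icc_eq_integral_Ioc, ← intervalIntegral.integral_of_le (by norm_num), integral_id]
  norm_num

theorem integral_sq_uniformHalf : ∫ t, t ^ 2 ∂uniformHalf = 1 / 12 := by
  rw [integral_Icc_eq_integral_Ioc, ← intervalIntegral.integral_of_le (by norm_num), integral_pow]
  norm_num

theorem memLp_eval_mul (ξ : ℕ → ℝ) (j : ℕ) :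
    MemLp (fun x : ℕ → ℝ => x j * ξ j) 2 (seqLaw uniformHalf) := by
  refine MemLp.of_bound (Measurable.aestronglyMeasurable (by fun_prop)) (1 / 2 * |ξ j|) ?_
  filter_upwards [ae_abs_le_half] with x hx
  rw [Real.norm_eq_abs, abs_mul]
  exact mul_le_mul_of_nonneg_right (hx j) (abs_nonneg _)

theorem integral_eval_mul (ξ : ℕ → ℝ) (j : ℕ) :
    ∫ x : ℕ → ℝ, x j * ξ j ∂(seqLaw uniformHalf) = 0 := by
  have h := (measurePreserving_eval_seqLaw uniformHalf j)
  rw [integral_mul_const, ← integral_map (φ := fun x : ℕ → ℝ => x j) (f := fun t => t)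
    h.measurable.aemeasurable (by fun_prop), h.map_eq, integral_uniformHalf, zero_mul]

theorem variance_eval_mul (ξ : ℕ → ℝ) (j : ℕ) :
    variance (fun x : ℕ → ℝ => x j * ξ j) (seqLaw uniformHalf) = ξ j ^ 2 / 12 := by
  have h := (measurePreserving_eval_seqLaw uniformHalf j)
  rw [variance_of_integral_eq_zero (memLp_eval_mul ξ j).aestronglyMeasurable.aemeasurable
    (integral_eval_mul ξ j)]
  simp only [mul_pow]
  rw [integral_mul_const, ← integral_map (φ := fun x : ℕ → ℝ => x j) (f := fun t => t ^ 2)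
    h.measurable.aemeasurable (by fun_prop), h.map_eq, integral_sq_uniformHalf]
  ring

theorem pairwise_indepFun_eval_mul (ξ : ℕ → ℝ) (ω : Measure ℝ) [IsProbabilityMeasure ω] :
    Pairwise fun i j => IndepFun (fun x : ℕ → ℝ => x i * ξ i) (fun x => x j * ξ j) (seqLaw ω) :=
  fun _ _ hij => (iIndepFun_infinitePi (P := fun _ : ℕ => ω) (X := fun j t => t * ξ j)
    (by fun_prop)).indepFun hij

/-- The difference is a sum of independent centred terms, so its second moment is the sum of the
variances `ξ_j² / 12`. -/
theorem lintegral_partialY_sub_sq (ξ : ℕ → ℝ) (k n : ℕ) :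
    ∫⁻ x, ENNReal.ofReal ((partialY ξ (n + k) x - partialY ξ k x) ^ 2) ∂(seqLaw uniformHalf) =
      ENNReal.ofReal ((∑ j ∈ Finset.range n, ξ (k + j) ^ 2) / 12) := by
  set X : ℕ → (ℕ → ℝ) → ℝ := fun j x => x (k + j) * ξ (k + j) with hX
  have hd : ∀ x, partialY ξ (n + k) x - partialY ξ k x = (∑ j ∈ Finset.range n, X j) x := by
    intro x
    rw [partialY, partialY, add_comm n k, Finset.sum_range_add, Finset.sum_apply]
    simp [hX]
  have hL : ∀ j, MemLp (X j) 2 (seqLaw uniformHalf) := fun j => memLp_eval_mul ξ (k + j)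
  have hLs : MemLp (∑ j ∈ Finset.range n, X j) 2 (seqLaw uniformHalf) :=
    memLp_finsetSum' _ fun j _ => hL j
  have h0 : ∫ x, (∑ j ∈ Finset.range n, X j) x ∂(seqLaw uniformHalf) = 0 := by
    simp only [Finset.sum_apply]
    rw [integral_finsetSum _ fun j _ => (hL j).integrable (by norm_num)]
    exact Finset.sum_eq_zero fun j _ => integral_eval_mul ξ (k + j)
  have hv := IndepFun.variance_sum (s := Finset.range n) (fun j _ => hL j)
    (fun i _ j _ hij => pairwise_indepFun_eval_mul ξ uniformHalf (by simpa using hij))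
  rw [variance_of_integral_eq_zero hLs.aestronglyMeasurable.aemeasurable h0] at hv
  simp only [hd]
  rw [← ofReal_integral_eq_lintegral_ofReal hLs.integrable_sq
    (Eventually.of_forall fun _ => sq_nonneg _), hv, Finset.sum_div]
  congr 1
  exact Finset.sum_congr rfl fun j _ => variance_eval_mul ξ (k + j)

theorem summable_sq (hξ : Summable fun j => |ξ j|) : Summable fun j => ξ j ^ 2 := by
  refine Summable.of_nonneg_of_le (fun j => sq_nonneg _) (fun j => ?_)
    (hξ.mul_left (∑' j, |ξ j|))
  rw [← sq_abs, sq]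
  exact mul_le_mul_of_nonneg_right (hξ.le_tsum j fun _ _ => abs_nonneg _) (abs_nonneg _)

theorem summable_sq_add (hξ : Summable fun j => |ξ j|) (k : ℕ) :
    Summable fun j => ξ (k + j) ^ 2 := by
  simpa only [add_comm k] using (summable_nat_add_iff k).mpr (summable_sq hξ)

/-- Fatou's lemma passes from the finite differences `Y_{n+k} - Y_k` to `Y_∞ - Y_k`; an inequality
suffices here. -/
theorem tailMoment_two_uniformHalf_le (hξ : Summable fun j => |ξ j|) (k : ℕ) :
    tailMoment 2 ξ uniformHalf k ≤ ENNReal.ofReal ((∑' j, ξ (k + j) ^ 2) / 12) := by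
  set F : ℕ → (ℕ → ℝ) → ℝ≥0∞ := fun n x =>
    ENNReal.ofReal ((partialY ξ (n + k) x - partialY ξ k x) ^ 2) with hF
  have hlim : ∀ᵐ x ∂(seqLaw uniformHalf),
      ENNReal.ofReal ((limitY ξ x - partialY ξ k x) ^ 2) = liminf (fun n => F n x) atTop := by
    filter_upwards [ae_abs_le_half] with x hx
    have hne := ne_top_of_le_ne_top ENNReal.ofReal_ne_top (absY_le_of_abs_le_half hξ hx)
    have ht := (tendsto_add_atTop_iff_nat k).mpr (tendsto_partialY hne)
    exact (ENNReal.tendsto_ofReal ((ht.sub_const (partialY ξ k x)).pow 2)).liminf_eq.symm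
  have hmeas : ∀ n, Measurable (F n) := fun n =>
    (((measurable_partialY ξ _).sub (measurable_partialY ξ k)).pow_const 2).ennreal_ofReal
  rw [tailMoment_two, lintegral_congr_ae hlim]
  refine (lintegral_liminf_le hmeas).trans ?_
  refine (liminf_le_liminf (Eventually.of_forall fun n => ?_)).trans_eq
    (liminf_const (f := (atTop : Filter ℕ)) _)
  rw [hF, lintegral_partialY_sub_sq]
  refine ENNReal.ofReal_le_ofReal ?_
  gcongr
  exact (summable_sq_add hξ k).sum_le_tsum _ fun _ _ => sq_nonneg _

theorem truncError_uniformHalf_le {r : ℕ → ℝ} (hr : ∀ ℓ, 0 < r ℓ)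
    (hV : Summable (fun ℓ : ℕ => r (ℓ + 1) * ((ℓ : ℝ) + 1) ^ (11 / 6 : ℝ)))
    (hξ : Summable fun j => |ξ j|) (k : ℕ) :
    truncError (hermiteKernel r) ξ uniformHalf k ≤
      ENNReal.ofReal (2 * Real.sqrt (Real.sqrt (2 * Real.pi) * weightSum r / 12) *
        Real.exp (1 / 16 * (∑' j : ℕ, |ξ j|) ^ 2) * Real.sqrt (∑' j : ℕ, ξ (k + j) ^ 2)) := by
  have hV0 := weightSum_pos hr hV
  have hE := eLpNorm_expE_absY_uniformHalf_le hξ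
  have hT : 0 ≤ ∑' j, ξ (k + j) ^ 2 := tsum_nonneg fun _ => sq_nonneg _
  have h := (lintegral_le_eLpNorm_mul_tailMoment k (hE.trans_lt ENNReal.ofReal_lt_top)).trans
    (mul_le_mul' hE (tailMoment_two_uniformHalf_le hξ k))
  refine (truncError_le hr hV ξ uniformHalf k).trans ?_
  refine (mul_le_mul' le_rfl (ENNReal.rpow_le_rpow (mul_le_mul' le_rfl h)
    (by norm_num))).trans_eq ?_
  rw [← ENNReal.ofReal_mul (Real.exp_pos _).le, ← ENNReal.ofReal_mul (by positivity),
    ENNReal.ofReal_rpow_of_nonneg (by positivity) (by norm_num), ← Real.sqrt_eq_rpow,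
    ← ENNReal.ofReal_mul (by norm_num)]
  congr 1
  have h1 : Real.sqrt (Real.exp (1 / 8 * (∑' j : ℕ, |ξ j|) ^ 2)) =
      Real.exp (1 / 16 * (∑' j : ℕ, |ξ j|) ^ 2) := by
    rw [← Real.exp_half]; ring_nf
  rw [← h1, mul_assoc (2 * _), ← Real.sqrt_mul (Real.exp_pos _).le, mul_assoc 2,
    ← Real.sqrt_mul (by positivity)]
  ring_nf

end Uniform

/-! ### Tail sums under power decay -/

section PowerDecay

/-- Midpoint convexity of `u ↦ u^{-q}`, by the arithmetic–geometric mean inequality and `(t-s)(t+s)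
≤ t²`. -/
theorem two_mul_rpow_neg_le {t s : ℝ} (hs : |s| < t) {q : ℝ} (hq : 0 ≤ q) :
    2 * t ^ (-q) ≤ (t - s) ^ (-q) + (t + s) ^ (-q) := by
  obtain ⟨h1, h2⟩ := abs_lt.mp hs
  have hu : 0 < t - s := by linarith
  have hv : 0 < t + s := by linarith
  have ht : 0 < t := by linarith
  have hA : 0 < (t - s) ^ (-q) := by positivity
  have hB : 0 < (t + s) ^ (-q) := by positivity
  have hprod : (t ^ (-q)) ^ 2 ≤ (t - s) ^ (-q) * (t + s) ^ (-q) := by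
    rw [← Real.mul_rpow hu.le hv.le, ← Real.rpow_natCast, ← Real.rpow_mul ht.le, mul_comm (-q),
      Real.rpow_mul ht.le, Real.rpow_natCast]
    refine Real.rpow_le_rpow_of_nonpos (by positivity) ?_ (by linarith)
    nlinarith [sq_nonneg s]
  refine abs_le_of_sq_le_sq' (b := _) ?_ (by positivity) |>.2
  nlinarith [sq_nonneg ((t - s) ^ (-q) - (t + s) ^ (-q))]

/-- The midpoint (Hermite–Hadamard) bound for the integral of `p u^{-(p+1)}` over `[t-1/2, t+1/2]`.
It is proved by widening the interval: `φ s` is the integral over `[t-s, t+s]` minus its midpoint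
value, `φ 0 = 0`, and convexity makes `φ` increase. -/
theorem mul_rpow_neg_le_sub {p t : ℝ} (hp : 0 < p) (ht : 1 ≤ t) :
    p * t ^ (-(p + 1)) ≤ (t - 1 / 2) ^ (-p) - (t + 1 / 2) ^ (-p) := by
  set φ : ℝ → ℝ := fun s => (t - s) ^ (-p) - (t + s) ^ (-p) - 2 * s * (p * t ^ (-(p + 1)))
  have hder : ∀ s ∈ Set.Icc (0 : ℝ) (1 / 2), HasDerivAt φ
      (p * ((t - s) ^ (-(p + 1)) + (t + s) ^ (-(p + 1)) - 2 * t ^ (-(p + 1)))) s := by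
    intro s hs
    have h1 := ((hasDerivAt_id s).const_sub t).rpow_const (p := -p)
      (Or.inl (by simp only [id]; linarith [hs.2]))
    have h2 := ((hasDerivAt_id s).const_add t).rpow_const (p := -p)
      (Or.inl (by simp only [id]; linarith [hs.1]))
    have h3 := ((hasDerivAt_id s).const_mul 2).mul_const (p * t ^ (-(p + 1)))
    refine ((h1.sub h2).sub h3).congr_deriv ?_
    simp only [id, show -p - 1 = -(p + 1) by ring]
    ring
  have hmono : MonotoneOn φ (Set.Icc 0 (1 / 2)) := by
    refine monotoneOn_of_deriv_nonneg (convex_Icc _ _)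
      (fun s hs => (hder s hs).continuousAt.continuousWithinAt)
      (fun s hs => (hder s (interior_subset hs)).differentiableAt.differentiableWithinAt) ?_
    intro s hs
    have hs' := interior_subset hs
    rw [(hder s hs').deriv]
    have := two_mul_rpow_neg_le (t := t) (s := s) (q := p + 1)
      (by rw [abs_of_nonneg hs'.1]; linarith [hs'.2]) (by linarith)
    exact mul_nonneg hp.le (by linarith)
  have h := hmono (by norm_num : (0 : ℝ) ∈ Set.Icc (0 : ℝ) (1 / 2))
    (by norm_num : (1 / 2 : ℝ) ∈ Set.Icc (0 : ℝ) (1 / 2)) (by norm_num)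
  simp only [φ] at h
  norm_num at h
  norm_num
  linarith

/-- The midpoint bound with `p = 2a - 1` at `t = k + j + 1` telescopes. Its first endpoint is `k +
1/2`, whence the shift by one half. -/
theorem tsum_sq_le_of_abs_le_rpow {ξ : ℕ → ℝ} {a : ℝ} (ha : 1 < a)
    (hb : ∀ j : ℕ, |ξ j| ≤ ((j : ℝ) + 1) ^ (-a)) (k : ℕ) :
    ∑' j, ξ (k + j) ^ 2 ≤ ((k : ℝ) + 1 / 2) ^ (-(2 * a - 1)) / (2 * a - 1) := by
  have hp : 0 < 2 * a - 1 := by linarith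
  refine Real.tsum_le_of_sum_range_le (fun j => sq_nonneg _) fun n => ?_
  set g : ℕ → ℝ := fun j => ((k : ℝ) + j + 1 / 2) ^ (-(2 * a - 1)) / (2 * a - 1)
  have hterm : ∀ j, ξ (k + j) ^ 2 ≤ g j - g (j + 1) := by
    intro j
    have h1 := pow_le_pow_left₀ (abs_nonneg _) (hb (k + j)) 2
    rw [sq_abs, ← Real.rpow_natCast (_ ^ (-a)), ← Real.rpow_mul (by positivity)] at h1
    have h2 := mul_rpow_neg_le_sub hp
      (by linarith [(k + j).cast_nonneg (α := ℝ)] : (1 : ℝ) ≤ ((k + j : ℕ) : ℝ) + 1)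
    rw [show -(2 * a - 1 + 1) = -a * (2 : ℕ) by push_cast; ring] at h2
    simp only [g]
    rw [← sub_div, le_div_iff₀ hp]
    refine (mul_le_mul_of_nonneg_right h1 hp.le).trans ?_
    rw [mul_comm]
    refine h2.trans_eq ?_
    push_cast
    ring_nf
  refine (Finset.sum_le_sum fun j _ => hterm j).trans ?_
  rw [Finset.sum_range_sub']
  have h0 : 0 ≤ g n := div_nonneg (by positivity) hp.le
  have h1 : g 0 = ((k : ℝ) + 1 / 2) ^ (-(2 * a - 1)) / (2 * a - 1) := by simp [g]
  linarith

theorem sqrt_tsum_sq_le_of_abs_le_rpow {ξ : ℕ → ℝ} {a : ℝ} (ha : 1 < a)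
    (hb : ∀ j : ℕ, |ξ j| ≤ ((j : ℝ) + 1) ^ (-a)) (k : ℕ) :
    Real.sqrt (∑' j, ξ (k + j) ^ 2) ≤
      1 / Real.sqrt (2 * a - 1) * (1 / ((k : ℝ) + 1 / 2) ^ (a - 1 / 2)) := by
  have hk : (0 : ℝ) < (k : ℝ) + 1 / 2 := by positivity
  refine (Real.sqrt_le_sqrt (tsum_sq_le_of_abs_le_rpow ha hb k)).trans_eq ?_
  rw [Real.sqrt_div (by positivity), Real.sqrt_eq_rpow (_ ^ _), ← Real.rpow_mul hk.le,
    show -(2 * a - 1) * (1 / 2) = -(a - 1 / 2) by ring, Real.rpow_neg hk.le]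
  ring

theorem riemannZeta_re_eq_tsum {a : ℝ} (ha : 1 < a) :
    (riemannZeta (a : ℂ)).re = ∑' j : ℕ, ((j : ℝ) + 1) ^ (-a) := by
  rw [zeta_eq_tsum_one_div_nat_add_one_cpow (by simpa using ha)]
  have h : ∀ n : ℕ, 1 / ((n : ℂ) + 1) ^ (a : ℂ) = ((((n : ℝ) + 1) ^ (-a) : ℝ) : ℂ) := by
    intro n
    rw [Real.rpow_neg (by positivity), Complex.ofReal_inv, Complex.ofReal_cpow (by positivity)]
    push_cast
    rw [one_div]
  simp_rw [h]
  rw [← Complex.ofReal_tsum, Complex.ofReal_re]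

theorem tsum_abs_le_riemannZeta {ξ : ℕ → ℝ} {a : ℝ} (ha : 1 < a) (hξ : Summable fun j => |ξ j|)
    (hb : ∀ j : ℕ, |ξ j| ≤ ((j : ℝ) + 1) ^ (-a)) :
    ∑' j, |ξ j| ≤ (riemannZeta (a : ℂ)).re := by
  rw [riemannZeta_re_eq_tsum ha]
  refine hξ.tsum_le_tsum hb ?_
  have h := (summable_nat_add_iff 1).mpr (Real.summable_nat_rpow.mpr (by linarith : -a < -1))
  simpa using h

end PowerDecay

end HermiteTruncation

/-! ### Assembly -/

theorem mainTheorem9 :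
    ∃ c : ℝ, 0 < c ∧
      ∀ r : ℕ → ℝ, (∀ ℓ, 0 < r ℓ) →
        Summable (fun ℓ : ℕ => r (ℓ + 1) * ((ℓ : ℝ) + 1) ^ (11 / 6 : ℝ)) →
        -- the kernel series converges and the kernel is such that the radicand is nonnegative
        (∀ x y : ℝ, Summable (fun ℓ : ℕ =>
          r ℓ * HermiteTruncation.hermiteFun ℓ x * HermiteTruncation.hermiteFun ℓ y)) ∧
        (∀ x y : ℝ, 0 ≤ HermiteTruncation.hermiteKernel r x x
          + HermiteTruncation.hermiteKernel r y y - 2 * HermiteTruncation.hermiteKernel r x y) ∧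
        ∀ ξ : ℕ → ℝ, Summable (fun j => |ξ j|) →
          ∀ (ω : Measure ℝ) [IsProbabilityMeasure ω] (k : ℕ),
            -- the main bound
            HermiteTruncation.truncError (HermiteTruncation.hermiteKernel r) ξ ω k ≤
              ENNReal.ofReal c *
                (ENNReal.ofReal (Real.sqrt (2 * Real.pi) * HermiteTruncation.weightSum r) *
                  ∫⁻ x, HermiteTruncation.expE (HermiteTruncation.absY ξ x ^ 2 / 2) *
                    ENNReal.ofReal ((HermiteTruncation.limitY ξ x
                      - HermiteTruncation.partialY ξ k x) ^ 2)
                    ∂(HermiteTruncation.seqLaw ω)) ^ (1 / 2 : ℝ) ∧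
            -- the case of bounded `exp ((Y_∞^abs)² / 2)`
            (eLpNorm (fun x => HermiteTruncation.expE (HermiteTruncation.absY ξ x ^ 2 / 2)) ∞
                (HermiteTruncation.seqLaw ω) < ∞ →
              HermiteTruncation.truncError (HermiteTruncation.hermiteKernel r) ξ ω k ≤
                ENNReal.ofReal c *
                  (ENNReal.ofReal (Real.sqrt (2 * Real.pi) * HermiteTruncation.weightSum r) *
                    eLpNorm (fun x =>
                      HermiteTruncation.expE (HermiteTruncation.absY ξ x ^ 2 / 2)) ∞
                      (HermiteTruncation.seqLaw ω) *
                    HermiteTruncation.tailMoment 2 ξ ω k) ^ (1 / 2 : ℝ)) ∧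
            -- the uniform distribution on `[-1/2, 1/2]`
            (ω = volume.restrict (Set.Icc (-(1 / 2) : ℝ) (1 / 2)) →
              eLpNorm (fun x => HermiteTruncation.expE (HermiteTruncation.absY ξ x ^ 2 / 2)) ∞
                  (HermiteTruncation.seqLaw ω) ≤
                ENNReal.ofReal (Real.exp (1 / 8 * (∑' j : ℕ, |ξ j|) ^ 2)) ∧
              HermiteTruncation.truncError (HermiteTruncation.hermiteKernel r) ξ ω k ≤
                ENNReal.ofReal
                  (c * Real.sqrt (Real.sqrt (2 * Real.pi) * HermiteTruncation.weightSum r / 12) *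
                    Real.exp (1 / 16 * (∑' j : ℕ, |ξ j|) ^ 2) *
                    Real.sqrt (∑' j : ℕ, ξ (k + j) ^ 2)) ∧
              ∀ a : ℝ, 1 < a → (∀ j : ℕ, |ξ j| ≤ ((j : ℝ) + 1) ^ (-a)) →
                HermiteTruncation.truncError (HermiteTruncation.hermiteKernel r) ξ ω k ≤
                  ENNReal.ofReal
                    (c * Real.sqrt
                        (Real.sqrt (2 * Real.pi) * HermiteTruncation.weightSum r / 12) *
                      Real.exp (1 / 16 * (riemannZeta (a : ℂ)).re ^ 2) /
                      Real.sqrt (2 * a - 1) *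
                      (1 / ((k : ℝ) + 1 / 2) ^ (a - 1 / 2)))) ∧
            -- the case where only `exp ((Y_∞^abs)²)` is integrable
            (∫⁻ x, HermiteTruncation.expE (HermiteTruncation.absY ξ x ^ 2)
                ∂(HermiteTruncation.seqLaw ω) < ∞ →
              ∫⁻ x, HermiteTruncation.expE (HermiteTruncation.absY ξ x ^ 2 / 2) *
                    ENNReal.ofReal ((HermiteTruncation.limitY ξ x
                      - HermiteTruncation.partialY ξ k x) ^ 2)
                    ∂(HermiteTruncation.seqLaw ω) ≤
                (∫⁻ x, HermiteTruncation.expE (HermiteTruncation.absY ξ x ^ 2)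
                    ∂(HermiteTruncation.seqLaw ω)) ^ (1 / 2 : ℝ) *
                  HermiteTruncation.tailMoment 4 ξ ω k ^ (1 / 2 : ℝ) ∧
              HermiteTruncation.truncError (HermiteTruncation.hermiteKernel r) ξ ω k ≤
                ENNReal.ofReal c *
                  (ENNReal.ofReal (Real.sqrt (2 * Real.pi) * HermiteTruncation.weightSum r) *
                    (∫⁻ x, HermiteTruncation.expE (HermiteTruncation.absY ξ x ^ 2)
                      ∂(HermiteTruncation.seqLaw ω)) ^ (1 / 2 : ℝ) *
                    HermiteTruncation.tailMoment 4 ξ ω k ^ (1 / 2 : ℝ)) ^ (1 / 2 : ℝ)) := by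
  refine ⟨2, by norm_num, fun r hr hV => ⟨HermiteTruncation.summable_hermiteKernel hr hV,
    HermiteTruncation.hermiteKernel_dist_nonneg hr hV, fun ξ hξ ω _ k => ?_⟩⟩
  have hmain := HermiteTruncation.truncError_le hr hV ξ ω k
  refine ⟨hmain, fun hE => ?_, ?_, fun hE => ?_⟩
  · refine hmain.trans (mul_le_mul' le_rfl (ENNReal.rpow_le_rpow ?_ (by norm_num)))
    rw [mul_assoc]
    exact mul_le_mul' le_rfl (HermiteTruncation.lintegral_le_eLpNorm_mul_tailMoment k hE)
  · rintro rfl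
    have hU := HermiteTruncation.truncError_uniformHalf_le hr hV hξ k
    refine ⟨HermiteTruncation.eLpNorm_expE_absY_uniformHalf_le hξ, hU, fun a ha hb => ?_⟩
    refine hU.trans (ENNReal.ofReal_le_ofReal ?_)
    have hS : 0 ≤ ∑' j, |ξ j| := tsum_nonneg fun _ => abs_nonneg _
    have hζ := HermiteTruncation.tsum_abs_le_riemannZeta ha hξ hb
    have hT := HermiteTruncation.sqrt_tsum_sq_le_of_abs_le_rpow ha hb k
    -- Both factors are monotone: `∑ |ξ_j| ≤ ζ(a)` in the exponential, and the tail bound in the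
    -- square root.
    refine (mul_le_mul (mul_le_mul_of_nonneg_left (Real.exp_le_exp.mpr
      (mul_le_mul_of_nonneg_left (pow_le_pow_left₀ hS hζ 2) (by norm_num))) (by positivity))
      hT (Real.sqrt_nonneg _) (by positivity)).trans_eq ?_
    ring
  · have h4 := HermiteTruncation.lintegral_le_sqrt_mul_sqrt k hE
    refine ⟨h4, hmain.trans (mul_le_mul' le_rfl (ENNReal.rpow_le_rpow ?_ (by norm_num)))⟩
    rw [mul_assoc]
    exact mul_le_mul' le_rfl h4
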